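/- Let $m,l\ge 1$ be integers. Let $EL_2(m\mathbb Z)\le SL_2(\mathbb Z)$ be the subgroup generated by all matrices $\begin{pmatrix}1&r\\0&1\end{pmatrix}$ and $\begin{pmatrix}1&0\\r&1\end{pmatrix}$ with $r\in m\mathbb Z$, acting on column vectors in $(l\mathbb Z)^2$ by matrix multiplication, and let $\Gamma=EL_2(m\mathbb Z)\ltimes(l\mathbb Z)^2$ and $B=(l\mathbb Z)^2\le\Gamma$. Let $$F(m,l)=\left\{\begin{pmatrix}1&\pm m\\0&1\end{pmatrix},\ \begin{pmatrix}1&0\\\pm m&1\end{pmatrix},\ \begin{pmatrix}\pm l\\0\end{pmatrix},\ \begin{pmatrix}0\\\pm l\end{pmatrix}\right\}\subset\Gamma .$$ For a subset $S\subseteq\Gamma$ and $\varepsilon\ge0$, call $\varepsilon$ admissible for $S$ if every unitary representation $(\pi,\mathcal H)$ of the discrete group $\Gamma$ on a complex Hilbert space that has a vector $v\neq0$ with $\|\pi(s)v-v\|\le\varepsilon\|v\|$ for all $s\in S$ also has a nonzero $B$-invariant vector. The pair $(\Gamma,B)$ has relative property (T) if some $\varepsilon>0$ is admissible for some finite generating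 set $S$ of $\Gamma$; the relative Kazhdan constant $\kappa(\Gamma,B;S)$ is the supremum of the $\varepsilon\geq 0$ admissible for $S$. Then $F(m,l)$ is a finite generating set of $\Gamma$, the pair $(\Gamma,B)$ has relative property (T), the number $\frac{1}{27}\sin\frac{\pi}{m}$ is itself admissible for $F(m,l)$, and $$\kappa(\Gamma,B;F(m,l))\ \ge\ \frac{\sin(\pi/m)}{27}.$$ -/

import Mathlib

open scoped MatrixGroups

universe u v

namespace RelKazhdan

section PropertyT

variable {Γ : Type v} [Group Γ]

/-- A nonzero vector `v` with `‖π(s)v - v‖ ≤ ε‖v‖` for every `s ∈ S`. -/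
def IsAlmostInvariant {H : Type u} [NormedAddCommGroup H] [InnerProductSpace ℂ H]
    [CompleteSpace H] (π : Γ →* unitary (H →L[ℂ] H)) (S : Set Γ) (ε : ℝ) (v : H) : Prop :=
  v ≠ 0 ∧ ∀ s ∈ S, ‖(π s : H →L[ℂ] H) v - v‖ ≤ ε * ‖v‖

/-- Every unitary representation of the discrete group `Γ` on a complex Hilbert space which has an
`(S, ε)`-invariant vector has a nonzero `B`-invariant vector. -/
def IsRelKazhdanBound (B : Subgroup Γ) (S : Set Γ) (ε : ℝ) : Prop :=
  ∀ (H : Type u) [NormedAddCommGroup H] [InnerProductSpace ℂ H] [CompleteSpace H]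
    (π : Γ →* unitary (H →L[ℂ] H)),
    (∃ v : H, IsAlmostInvariant π S ε v) →
      ∃ w : H, w ≠ 0 ∧ ∀ b ∈ B, (π b : H →L[ℂ] H) w = w

/-- Relative property (T) of the pair `(Γ, B)`. -/
def HasRelPropertyT (B : Subgroup Γ) : Prop :=
  ∃ S : Set Γ, S.Finite ∧ Subgroup.closure S = ⊤ ∧
    ∃ ε : ℝ, 0 < ε ∧ IsRelKazhdanBound.{u} B S ε

/-- The relative Kazhdan constant `κ(Γ, B; S)`, with values in the extended reals (it is `⊤` exactly
when every `ε` is admissible, as happens for trivial `B`). -/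
noncomputable def relKazhdanConstant (B : Subgroup Γ) (S : Set Γ) : EReal :=
  sSup ((fun ε : ℝ => (ε : EReal)) '' {ε : ℝ | 0 ≤ ε ∧ IsRelKazhdanBound.{u} B S ε})

end PropertyT

/-- The ring (without unit, in general) `R_m = mℤ`. -/
def R (m : ℕ) : NonUnitalSubring ℤ where
  carrier := {x | (m : ℤ) ∣ x}
  add_mem' := fun ha hb => dvd_add ha hb
  zero_mem' := dvd_zero _
  mul_mem' := fun ha _ => Dvd.dvd.mul_right ha _
  neg_mem' := fun ha => (dvd_neg).2 ha

/-- `EL_n(R')`: the group generated by the elementary matrices `X_{ij}(r)` with `r ∈ R'`. -/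
def EL (n : ℕ) (R' : NonUnitalSubring ℤ) : Subgroup SL(n, ℤ) :=
  Subgroup.closure {g | ∃ (i j : Fin n) (hij : i ≠ j), ∃ r ∈ R',
    g = Matrix.SpecialLinearGroup.transvection hij r}

theorem transvection_mem_EL {n : ℕ} {R' : NonUnitalSubring ℤ} {i j : Fin n} (hij : i ≠ j) {r : ℤ}
    (hr : r ∈ R') : Matrix.SpecialLinearGroup.transvection hij r ∈ EL n R' :=
  Subgroup.subset_closure ⟨i, j, hij, r, hr, rfl⟩

/-- `(R_l)^2 = (lℤ)^2` as a subgroup of `ℤ^2`. -/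
def RSq (l : ℕ) : AddSubgroup (Fin 2 → ℤ) where
  carrier := {v | ∀ i, v i ∈ R l}
  add_mem' := fun ha hb i => add_mem (ha i) (hb i)
  zero_mem' := fun _ => zero_mem _
  neg_mem' := fun ha i => neg_mem (ha i)

theorem smul_mem_RSq {l : ℕ} (g : SL(2, ℤ)) {v : Fin 2 → ℤ} (hv : v ∈ RSq l) :
    g.1.mulVec v ∈ RSq l := fun i => by
  change (l : ℤ) ∣ ∑ j, g.1 i j * v j
  exact Finset.dvd_sum fun j _ => Dvd.dvd.mul_left (hv j) _

/-- `EL_2(R_m)` acts on the column vectors in `(R_l)^2` by matrix multiplication. -/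
instance (m l : ℕ) : DistribMulAction (EL 2 (R m)) (RSq l) where
  smul g v := ⟨g.1.1.mulVec v.1, smul_mem_RSq g.1 v.2⟩
  one_smul v := Subtype.ext (Matrix.one_mulVec v.1)
  mul_smul g h v := Subtype.ext (Matrix.mulVec_mulVec v.1 g.1.1 h.1.1).symm
  smul_zero g := Subtype.ext (Matrix.mulVec_zero g.1.1)
  smul_add g v w := Subtype.ext (Matrix.mulVec_add g.1.1 v.1 w.1)

/-- The same action as a homomorphism to the automorphism group of `(R_l)^2`, written
multiplicatively. -/
def actHom (m l : ℕ) : EL 2 (R m) →* MulAut (Multiplicative (RSq l)) where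
  toFun g := AddEquiv.toMultiplicative (DistribMulAction.toAddEquiv (RSq l) g)
  map_one' := MulEquiv.ext fun v => congrArg Multiplicative.ofAdd (one_smul (EL 2 (R m)) v.toAdd)
  map_mul' g h := MulEquiv.ext fun v => congrArg Multiplicative.ofAdd (mul_smul g h v.toAdd)

/-- The semidirect product `EL_2(R_m) ⋉ (R_l)^2`. -/
abbrev SDP (m l : ℕ) : Type :=
  Multiplicative (RSq l) ⋊[actHom m l] (EL 2 (R m))

/-- The normal subgroup `(R_l)^2` of `EL_2(R_m) ⋉ (R_l)^2`. -/
def vecSubgroup (m l : ℕ) : Subgroup (SDP m l) :=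
  (SemidirectProduct.inl : Multiplicative (RSq l) →* SDP m l).range

/-- The elementary matrix with entry `r ∈ R_m` at the place `(i, j)`, in `EL_2(R_m) ⋉ (R_l)^2`. -/
def elem (m l : ℕ) {i j : Fin 2} (hij : i ≠ j) (r : R m) : SDP m l :=
  SemidirectProduct.inr ⟨Matrix.SpecialLinearGroup.transvection hij r.1,
    transvection_mem_EL hij r.2⟩

/-- The vector `(a, b)^t ∈ (R_l)^2`, in `EL_2(R_m) ⋉ (R_l)^2`. -/
def vec (m l : ℕ) (a b : R l) : SDP m l :=
  SemidirectProduct.inl (Multiplicative.ofAdd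
    ⟨![a.1, b.1], fun i => by fin_cases i; exacts [a.2, b.2]⟩)

/-- The element `m` of `R_m = mℤ`. -/
def gen (m : ℕ) : R m := ⟨m, dvd_refl (m : ℤ)⟩

/-- `F(m,l) = {U^±(m), L^±(m), e^±(l), f^±(l)}`. -/
def F (m l : ℕ) : Set (SDP m l) :=
  {elem m l (zero_ne_one (α := Fin 2)) (gen m), elem m l (zero_ne_one (α := Fin 2)) (-gen m),
    elem m l (one_ne_zero (α := Fin 2)) (gen m), elem m l (one_ne_zero (α := Fin 2)) (-gen m),
    vec m l (gen l) 0, vec m l (-gen l) 0, vec m l 0 (gen l), vec m l 0 (-gen l)}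

end RelKazhdan

/-!
The abelian group `(lℤ)²` is generated by the vectors `e = (l, 0)` and `f = (0, l)`. In a unitary
representation these become two commuting unitaries, whose joint functional calculus, obtained from
Gelfand duality, is a representation `Ψ` of the algebra of continuous functions on the torus
(`exists_torusHom`). By the Riesz–Markov–Kakutani theorem every vector `v` has a spectral measure
`μ` on the torus (`exists_isSpectralMeasure`). An atom of `μ` at the origin produces a nonzero
vector fixed by `e` and `f`
(`IsSpectralMeasure.exists_invariant_of_measure_zero_ne_zero`), so suppose that there is none.

Let `v` be an almost invariant unit vector. Since `e` and `f` hardly move `v`, Chebyshev's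
inequality confines all but `8/729` of the mass of `μ` to the square `‖x‖, ‖y‖ ≤ 1 / (4k)`, where
`k = m`. The elementary matrices with entries `±k` act on the torus by shears, and because they
hardly move `v` they change the measure of a closed set by at most `2ε`
(`IsSpectralMeasure.measureReal_le_preimage`). On the small square the shears do not wrap around
the torus. For `k ≥ 2` the two vertical shears therefore carry the cone `‖y‖ ≤ ‖x‖` into two parts
of the cone `‖x‖ ≤ ‖y‖` that meet only at the origin, and symmetrically for the horizontal
shears. Each cone thus has, up to small errors, at most half the mass of the other, so both have
small mass; but together with the small complement of the square they carry the total mass `1`,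
which is absurd for `ε ≤ 1/27` (`exists_fixed_of_almost_fixed_unit`).

For `m = 1` the number `sin (π / m)` vanishes, and relative property (T) is obtained by running the
argument with the squares of the elementary matrices, that is, with `k = 2`.
-/

open MeasureTheory Filter Topology WeakDual
open scoped CStarAlgebra

/-! ### Functional calculus on the torus -/

/-- The two-dimensional torus `(ℝ/ℤ)²`, the Pontryagin dual of `ℤ²`. -/
abbrev Torus : Type := UnitAddCircle × UnitAddCircle

namespace Torus

/-- The character `(x, y) ↦ exp (2πix)` of the torus. -/
noncomputable def fstChar : C(Torus, ℂ) :=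
  (fourier 1).comp ⟨Prod.fst, continuous_fst⟩

/-- The character `(x, y) ↦ exp (2πiy)` of the torus. -/
noncomputable def sndChar : C(Torus, ℂ) :=
  (fourier 1).comp ⟨Prod.snd, continuous_snd⟩

@[simp] theorem fstChar_apply (p : Torus) : fstChar p = AddCircle.toCircle p.1 := by
  simp [fstChar]

@[simp] theorem sndChar_apply (p : Torus) : sndChar p = AddCircle.toCircle p.2 := by
  simp [sndChar]

/-- By Stone–Weierstrass, the two coordinate characters generate `C(Torus, ℂ)`. -/
theorem starAlgHom_ext {B : Type*} [CStarAlgebra B] {φ ψ : C(Torus, ℂ) →⋆ₐ[ℂ] B}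
    (h₁ : φ fstChar = ψ fstChar) (h₂ : φ sndChar = ψ sndChar) : φ = ψ := by
  let S : StarSubalgebra ℂ C(Torus, ℂ) := StarAlgebra.adjoin ℂ {fstChar, sndChar}
  have hS : S.topologicalClosure = ⊤ := by
    apply ContinuousMap.starSubalgebra_topologicalClosure_eq_top_of_separatesPoints
    intro p q hpq
    by_cases h : p.1 = q.1
    · have h' : p.2 ≠ q.2 := fun h' => hpq (Prod.ext h h')
      refine ⟨_, ⟨sndChar, StarAlgebra.subset_adjoin ℂ _ (by simp), rfl⟩, fun h'' => h' ?_⟩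
      exact AddCircle.injective_toCircle one_ne_zero (Subtype.coe_injective (by simpa using h''))
    · refine ⟨_, ⟨fstChar, StarAlgebra.subset_adjoin ℂ _ (by simp), rfl⟩, fun h'' => h ?_⟩
      exact AddCircle.injective_toCircle one_ne_zero (Subtype.coe_injective (by simpa using h''))
  suffices (⊤ : StarSubalgebra ℂ C(Torus, ℂ)) ≤ StarAlgHom.equalizer φ ψ from
    StarAlgHom.ext fun x => this (by trivial)
  rw [← hS]
  refine StarSubalgebra.topologicalClosure_minimal ?_
    (isClosed_eq (map_continuous φ) (map_continuous ψ))
  refine StarAlgebra.adjoin_le ?_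
  rintro x (rfl | rfl)
  exacts [h₁, h₂]

end Torus


/-- In a commutative C⋆-algebra a pair of unitaries defines a map from the character space to the
torus; composing with it and inverting the Gelfand transform gives the functional calculus. -/
theorem exists_torusHom_of_comm {A : Type*} [CommCStarAlgebra A] (a b : unitary A) :
    ∃ Ψ : C(Torus, ℂ) →⋆ₐ[ℂ] A, Ψ Torus.fstChar = a ∧ Ψ Torus.sndChar = b := by
  have key : ∀ a : unitary A, ∃ q : C(characterSpace ℂ A, UnitAddCircle),
      ∀ χ, (AddCircle.toCircle (q χ) : ℂ) = χ (a : A) := by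
    intro a
    have h1 : ∀ χ : characterSpace ℂ A, ∃ z : Circle, (z : ℂ) = χ (a : A) := by
      intro χ
      have : χ (a : A) ∈ unitary ℂ := Unitary.map_mem χ a.2
      exact ⟨⟨χ (a : A), mem_sphere_zero_iff_norm.2 (CStarRing.norm_of_mem_unitary this)⟩, rfl⟩
    choose c hc using h1
    have hcc : Continuous c := continuous_induced_rng.2 <| by
      convert! map_continuous (gelfandTransform ℂ A (a : A)) using 1
      exact funext hc
    refine ⟨⟨fun χ => (AddCircle.homeomorphCircle one_ne_zero).symm (c χ),
      (Homeomorph.continuous _).comp hcc⟩, fun χ => ?_⟩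
    rw [ContinuousMap.coe_mk, ← AddCircle.homeomorphCircle_apply one_ne_zero,
      Homeomorph.apply_symm_apply, hc]
  obtain ⟨q, hq⟩ := key a
  obtain ⟨r, hr⟩ := key b
  refine ⟨((gelfandStarTransform A).symm : C(characterSpace ℂ A, ℂ) →⋆ₐ[ℂ] A).comp
    (ContinuousMap.compStarAlgHom' ℂ ℂ (q.prodMk r)), ?_, ?_⟩
  · change (gelfandStarTransform A).symm _ = _
    rw [StarAlgEquiv.symm_apply_eq]
    ext χ
    exact (Torus.fstChar_apply _).trans (hq χ)
  · change (gelfandStarTransform A).symm _ = _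
    rw [StarAlgEquiv.symm_apply_eq]
    ext χ
    exact (Torus.sndChar_apply _).trans (hr χ)

/-- The continuous functional calculus of a commuting pair of unitaries. -/
theorem exists_torusHom {B : Type*} [CStarAlgebra B] (a b : unitary B)
    (hab : a * b = b * a) :
    ∃ Ψ : C(Torus, ℂ) →⋆ₐ[ℂ] B, Ψ Torus.fstChar = a ∧ Ψ Torus.sndChar = b := by
  let s : Set B := {(a : B), (b : B)}
  have hab' : (a : B) * b = b * a := congrArg Subtype.val hab
  have hc : ∀ x ∈ s, ∀ y ∈ s, x * y = y * x := by
    rintro x (rfl | rfl) y (rfl | rfl) <;> first | rfl | exact hab' | exact hab'.symm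
  have hcs : ∀ x ∈ s, ∀ y ∈ s, x * star y = star y * x := by
    have h1 : a * star b = star b * a := by
      rw [Unitary.star_eq_inv]; exact (Commute.inv_right hab)
    have h2 : b * star a = star a * b := by
      rw [Unitary.star_eq_inv]; exact (Commute.inv_right (Eq.symm hab))
    rintro x (rfl | rfl) y (rfl | rfl)
    · simp
    · exact congrArg Subtype.val h1
    · exact congrArg Subtype.val h2
    · simp
  have hcomm := StarAlgebra.isMulCommutative_adjoin ℂ hc hcs
  let S := (StarAlgebra.adjoin ℂ s).topologicalClosure
  have hS : IsClosed (S : Set B) := StarSubalgebra.isClosed_topologicalClosure _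
  let iC : CommRing S := StarSubalgebra.commRingTopologicalClosure _
    (fun x y => hcomm.is_comm.comm x y)
  let _ : NormedCommRing S := { SubringClass.toNormedRing S with mul_comm := iC.mul_comm }
  let _ : CompleteSpace S := hS.completeSpace_coe
  let _ : CommCStarAlgebra S := { }
  have ha : (a : B) ∈ S := subset_closure (StarAlgebra.subset_adjoin ℂ s (by simp [s]))
  have hb : (b : B) ∈ S := subset_closure (StarAlgebra.subset_adjoin ℂ s (by simp [s]))
  let a' : unitary S := ⟨⟨a, ha⟩, by
    rw [Unitary.mem_iff]; exact ⟨Subtype.ext (by simp), Subtype.ext (by simp)⟩⟩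
  let b' : unitary S := ⟨⟨b, hb⟩, by
    rw [Unitary.mem_iff]; exact ⟨Subtype.ext (by simp), Subtype.ext (by simp)⟩⟩
  obtain ⟨Ψ, h1, h2⟩ := exists_torusHom_of_comm a' b'
  refine ⟨S.subtype.comp Ψ, ?_, ?_⟩
  · simp [h1, a']
  · simp [h2, b']

/-! ### Spectral measures -/

section SpectralMeasure

/-- A real continuous function on the torus, viewed as a complex one. -/
noncomputable def Torus.ofReal : C(Torus, ℝ) →L[ℝ] C(Torus, ℂ) :=
  Complex.ofRealCLM.compLeftContinuous ℝ Torus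

@[simp] theorem Torus.ofReal_apply (g : C(Torus, ℝ)) (p : Torus) :
    Torus.ofReal g p = (g p : ℂ) := rfl

variable {H : Type u} [NormedAddCommGroup H] [InnerProductSpace ℂ H] [CompleteSpace H]

/-- `μ` is the spectral measure of the vector `v` for the representation `Ψ` of `C(Torus, ℂ)`:
integration against `μ` is the vector state of `v`. -/
def IsSpectralMeasure (Ψ : C(Torus, ℂ) →⋆ₐ[ℂ] (H →L[ℂ] H)) (v : H) (μ : Measure Torus) : Prop :=
  ∀ g : C(Torus, ℝ), ∫ p, g p ∂μ = (inner ℂ (Ψ (Torus.ofReal g) v) v).re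

theorem inner_map_star_mul_self (Ψ : C(Torus, ℂ) →⋆ₐ[ℂ] (H →L[ℂ] H)) (v : H) (h : C(Torus, ℂ)) :
    (inner ℂ (Ψ (star h * h) v) v).re = ‖Ψ h v‖ ^ 2 := by
  rw [map_mul, map_star, ContinuousLinearMap.star_eq_adjoint, mul_apply_eq_comp,
    ContinuousLinearMap.adjoint_inner_left, inner_self_eq_norm_sq_to_K]
  norm_cast

theorem exists_isSpectralMeasure (Ψ : C(Torus, ℂ) →⋆ₐ[ℂ] (H →L[ℂ] H)) (v : H) :
    ∃ μ : Measure Torus, IsFiniteMeasure μ ∧ IsSpectralMeasure Ψ v μ := by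
  let Λ₀ : CompactlySupportedContinuousMap Torus ℝ →ₗ[ℝ] ℝ :=
    { toFun := fun g => (inner ℂ (Ψ (Torus.ofReal g.1) v) v).re
      map_add' := fun g h => by
        have : (g + h).1 = g.1 + h.1 := rfl
        rw [this, map_add, map_add, add_apply, inner_add_left, Complex.add_re]
      map_smul' := fun c g => by
        have h1 : (c • g).1 = c • g.1 := rfl
        have h2 : Torus.ofReal (c • g.1) = (c : ℂ) • Torus.ofReal g.1 := by
          ext p; simp
        rw [h1, h2, map_smul, smul_apply, inner_smul_left]
        simp }
  have hpos : ∀ g, 0 ≤ g → 0 ≤ Λ₀ g := by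
    intro g hg
    let s : C(Torus, ℝ) := ⟨fun p => √(g p), by fun_prop⟩
    have : Torus.ofReal g.1 = star (Torus.ofReal s) * Torus.ofReal s := by
      ext p
      simp only [Torus.ofReal_apply, ContinuousMap.mul_apply, ContinuousMap.star_apply, s,
        ContinuousMap.coe_mk, RCLike.star_def, Complex.conj_ofReal, ← Complex.ofReal_mul,
        Real.mul_self_sqrt (hg p)]
      rfl
    change 0 ≤ (inner ℂ (Ψ (Torus.ofReal g.1) v) v).re
    rw [this, inner_map_star_mul_self]
    positivity
  let Λ : CompactlySupportedContinuousMap Torus ℝ →ₚ[ℝ] ℝ :=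
    { Λ₀ with
      monotone' := fun g h hgh => by
        have := hpos (h - g) (sub_nonneg.2 hgh)
        rw [map_sub] at this
        exact sub_nonneg.1 this }
  refine ⟨RealRMK.rieszMeasure Λ, inferInstance, fun g => ?_⟩
  exact RealRMK.integral_rieszMeasure Λ ⟨g, HasCompactSupport.of_compactSpace _⟩

namespace IsSpectralMeasure

variable {Ψ : C(Torus, ℂ) →⋆ₐ[ℂ] (H →L[ℂ] H)} {v : H} {μ : Measure Torus}

theorem norm_sq (hμ : IsSpectralMeasure Ψ v μ) (h : C(Torus, ℂ)) :
    ‖Ψ h v‖ ^ 2 = ∫ p, ‖h p‖ ^ 2 ∂μ := by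
  let g : C(Torus, ℝ) := ⟨fun p => ‖h p‖ ^ 2, by fun_prop⟩
  have hg : Torus.ofReal g = star h * h := by
    ext p
    simp [g, Complex.conj_mul']
  rw [← inner_map_star_mul_self, ← hg, ← hμ g]
  rfl

theorem measureReal_univ (hμ : IsSpectralMeasure Ψ v μ) : μ.real Set.univ = ‖v‖ ^ 2 := by
  simpa using (hμ.norm_sq 1).symm

/-- Chebyshev's inequality for the displacement of `v` under a character. -/
theorem measureReal_le_of_norm_sub_le [IsFiniteMeasure μ] (hμ : IsSpectralMeasure Ψ v μ)
    (χ : C(Torus, ℂ)) {ε c : ℝ} (hc : 0 < c) (hv : ‖Ψ χ v - v‖ ≤ ε) {D : Set Torus}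
    (hD : MeasurableSet D) (hχ : ∀ p ∈ D, c ≤ ‖χ p - 1‖) : μ.real D ≤ ε ^ 2 / c ^ 2 := by
  have h1 : ‖Ψ (χ - 1) v‖ ^ 2 ≤ ε ^ 2 := by
    rw [map_sub, map_one]
    exact pow_le_pow_left₀ (norm_nonneg _) hv 2
  rw [hμ.norm_sq] at h1
  rw [le_div_iff₀ (by positivity)]
  refine le_trans ?_ h1
  have hint : Integrable (fun p => ‖(χ - 1) p‖ ^ 2) μ :=
    (Continuous.integrable_of_hasCompactSupport (by fun_prop) (HasCompactSupport.of_compactSpace _))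
  calc μ.real D * c ^ 2 = ∫ p in D, c ^ 2 ∂μ := by simp
    _ ≤ ∫ p in D, ‖(χ - 1) p‖ ^ 2 ∂μ := by
        refine setIntegral_mono_on (by simp) hint.integrableOn hD fun p hp => ?_
        exact pow_le_pow_left₀ hc.le (hχ p hp) 2
    _ ≤ _ := setIntegral_le_integral hint (ae_of_all _ fun p => by positivity)

/-- If `W` intertwines `Ψ` with its pullback along `τ` and moves the unit vector `v` by at most
`ε`, then `τ` does not decrease the spectral measure of closed sets by more than `2ε`. -/
theorem measureReal_le_preimage [IsFiniteMeasure μ] (hμ : IsSpectralMeasure Ψ v μ)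
    (W : unitary (H →L[ℂ] H)) (τ : C(Torus, Torus))
    (hW : ∀ h, Ψ h * W = (W : H →L[ℂ] H) * Ψ (h.comp τ)) (hv : ‖v‖ = 1) {ε : ℝ}
    (hε : ‖(W : H →L[ℂ] H) v - v‖ ≤ ε) {D : Set Torus} (hD : IsClosed D) :
    μ.real D ≤ μ.real (τ ⁻¹' D) + 2 * ε := by
  have hWv : ‖(W : H →L[ℂ] H) v‖ = 1 := by rw [Unitary.norm_map, hv]
  -- The inequality for continuous functions with values in `[0, 1]`.
  have key : ∀ g : C(Torus, ℝ), (∀ p, 0 ≤ g p ∧ g p ≤ 1) →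
      ∫ p, g p ∂μ ≤ ∫ p, g (τ p) ∂μ + 2 * ε := by
    intro g hg
    have h1 : ∫ p, g (τ p) ∂μ = (inner ℂ (Ψ (Torus.ofReal (g.comp τ)) v) v).re := hμ (g.comp τ)
    have h2 : Torus.ofReal (g.comp τ) = (Torus.ofReal g).comp τ := rfl
    have h3 : (inner ℂ (Ψ ((Torus.ofReal g).comp τ) v) v : ℂ)
        = inner ℂ (Ψ (Torus.ofReal g) ((W : H →L[ℂ] H) v)) ((W : H →L[ℂ] H) v) := by
      have := congrArg (fun T : H →L[ℂ] H => T v) (hW (Torus.ofReal g))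
      simp only [mul_apply_eq_comp] at this
      rw [this, Unitary.inner_map_map]
    rw [h1, h2, h3, hμ g]
    set T := Ψ (Torus.ofReal g)
    set w := (W : H →L[ℂ] H) v
    have hT : ‖T‖ ≤ 1 := (NonUnitalStarAlgHom.norm_apply_le Ψ _).trans <| by
      refine (ContinuousMap.norm_le _ zero_le_one).2 fun p => ?_
      rw [Torus.ofReal_apply, Complex.norm_real, Real.norm_eq_abs, abs_of_nonneg (hg p).1]
      exact (hg p).2
    have h4 : (inner ℂ (T v) v : ℂ) - inner ℂ (T w) w
        = inner ℂ (T v) (v - w) + inner ℂ (T (v - w)) w := by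
      rw [map_sub, inner_sub_left, inner_sub_right]; ring
    have hvw : ‖v - w‖ ≤ ε := by rwa [norm_sub_rev]
    have hTx : ∀ x, ‖T x‖ ≤ ‖x‖ := fun x =>
      (T.le_opNorm x).trans (mul_le_of_le_one_left (norm_nonneg _) hT)
    have h5 : ‖(inner ℂ (T v) v : ℂ) - inner ℂ (T w) w‖ ≤ 2 * ε := by
      rw [h4]
      refine (norm_add_le _ _).trans ?_
      have a1 := norm_inner_le_norm (𝕜 := ℂ) (T v) (v - w)
      have a2 := norm_inner_le_norm (𝕜 := ℂ) (T (v - w)) w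
      have a3 := hTx v
      have a4 := hTx (v - w)
      rw [hv] at a3
      rw [hWv] at a2
      nlinarith [norm_nonneg (v - w), norm_nonneg (T v)]
    have h6 := (Complex.re_le_norm _).trans h5
    rw [Complex.sub_re] at h6
    linarith
  -- Approximate the closed set from outside by continuous functions.
  have hD' : IsClosed (τ ⁻¹' D) := hD.preimage τ.continuous
  let g : ℕ → C(Torus, ℝ) := fun n =>
    ⟨fun p => (hD.apprSeq n p : ℝ), by fun_prop⟩
  have hlim : ∀ σ : C(Torus, Torus), Tendsto (fun n => ∫ p, g n (σ p) ∂μ) atTop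
      (𝓝 (μ.real (σ ⁻¹' D))) := by
    intro σ
    have hm : MeasurableSet (σ ⁻¹' D) := (hD.preimage σ.continuous).measurableSet
    rw [← integral_indicator_one hm]
    refine tendsto_integral_of_dominated_convergence (fun _ => 1) ?_ (by simp) ?_ ?_
    · intro n
      exact ((g n).continuous.comp σ.continuous).aestronglyMeasurable
    · intro n
      refine ae_of_all _ fun p => ?_
      have := HasOuterApproxClosed.apprSeq_apply_le_one hD n (σ p)
      simpa [g] using this
    · refine ae_of_all _ fun p => ?_
      have := tendsto_pi_nhds.1 (HasOuterApproxClosed.tendsto_apprSeq hD) (σ p)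
      have := (NNReal.continuous_coe.tendsto _).comp this
      convert! this using 2
      by_cases hp : σ p ∈ D <;> simp [hp]
  refine le_of_tendsto_of_tendsto' (hlim (ContinuousMap.id _)) ((hlim τ).add_const _) fun n => ?_
  refine key (g n) fun p => ⟨by simp [g], ?_⟩
  simpa [g] using HasOuterApproxClosed.apprSeq_apply_le_one hD n p

/-- An atom of the spectral measure at the trivial character yields a vector fixed by the two
generating unitaries. The continuous functions `t ^ n` decrease to the indicator of the trivial
character, and the vectors `Ψ (t ^ n) v` converge to the required vector. -/
theorem exists_invariant_of_measure_zero_ne_zero [IsFiniteMeasure μ]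
    (hμ : IsSpectralMeasure Ψ v μ) (h0 : μ {0} ≠ 0) :
    ∃ w : H, w ≠ 0 ∧ Ψ Torus.fstChar w = w ∧ Ψ Torus.sndChar w = w := by
  let t : C(Torus, ℝ) :=
    ⟨fun p => 1 - (‖Torus.fstChar p - 1‖ ^ 2 + ‖Torus.sndChar p - 1‖ ^ 2) / 8, by fun_prop⟩
  have hle : ∀ z : Circle, ‖(z : ℂ) - 1‖ ≤ 2 := fun z =>
    (norm_sub_le _ _).trans (by rw [Circle.norm_coe, norm_one]; norm_num)
  have ht0 : ∀ p, 0 ≤ t p := fun p => by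
    have h1 := hle (AddCircle.toCircle p.1)
    have h2 := hle (AddCircle.toCircle p.2)
    simp only [t, ContinuousMap.coe_mk, Torus.fstChar_apply, Torus.sndChar_apply]
    nlinarith [norm_nonneg ((AddCircle.toCircle p.1 : ℂ) - 1),
      norm_nonneg ((AddCircle.toCircle p.2 : ℂ) - 1)]
  have ht1 : ∀ p, t p ≤ 1 := fun p => by
    simp only [t, ContinuousMap.coe_mk]
    have : 0 ≤ ‖Torus.fstChar p - 1‖ ^ 2 + ‖Torus.sndChar p - 1‖ ^ 2 := by positivity
    linarith
  have htz : t 0 = 1 := by simp [t]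
  have htlt : ∀ p, p ≠ 0 → t p < 1 := fun p hp => by
    refine lt_of_le_of_ne (ht1 p) fun h => hp ?_
    have h1 : ‖Torus.fstChar p - 1‖ ^ 2 + ‖Torus.sndChar p - 1‖ ^ 2 = 0 := by
      simp only [t, ContinuousMap.coe_mk] at h
      linarith
    obtain ⟨h2, h3⟩ := (add_eq_zero_iff_of_nonneg (sq_nonneg _) (sq_nonneg _)).1 h1
    have aux : ∀ x : UnitAddCircle, ‖(AddCircle.toCircle x : ℂ) - 1‖ ^ 2 = 0 → x = 0 := by
      intro x hx
      apply AddCircle.injective_toCircle one_ne_zero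
      apply Subtype.coe_injective
      simpa [sub_eq_zero] using hx
    exact Prod.ext (aux _ (by simpa using h2)) (aux _ (by simpa using h3))
  let ind : Torus → ℝ := Set.indicator {0} 1
  have hind0 : ind 0 = 1 := by simp [ind]
  have hind : ∀ p, p ≠ 0 → ind p = 0 := fun p hp => by simp [ind, hp]
  let I : ℕ → ℝ := fun n => ∫ p, |t p ^ n - ind p| ^ 2 ∂μ
  have hmeas : ∀ n, AEStronglyMeasurable (fun p => |t p ^ n - ind p| ^ 2) μ := fun n => by
    have : Measurable ind := measurable_one.indicator (measurableSet_singleton 0)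
    have h2 : Measurable fun p => t p := t.continuous.measurable
    exact (Measurable.aestronglyMeasurable (by fun_prop))
  have hbd : ∀ n p, |t p ^ n - ind p| ^ 2 ≤ 1 := fun n p => by
    rw [sq_le_one_iff_abs_le_one, abs_abs]
    by_cases hp : p = 0
    · simp [hp, htz, hind0]
    · rw [hind p hp, sub_zero, abs_of_nonneg (pow_nonneg (ht0 p) n)]
      exact pow_le_one₀ (ht0 p) (ht1 p)
  have hI : Tendsto I atTop (𝓝 0) := by
    have : Tendsto I atTop (𝓝 (∫ p, (0 : ℝ) ∂μ)) := by
      refine tendsto_integral_of_dominated_convergence (fun _ => 1) hmeas (by simp) ?_ ?_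
      · intro n
        refine ae_of_all _ fun p => ?_
        rw [Real.norm_of_nonneg (by positivity)]
        exact hbd n p
      · refine ae_of_all _ fun p => ?_
        by_cases hp : p = 0
        · simp [hp, htz, hind0]
        · simpa [hind p hp] using
            ((tendsto_pow_atTop_nhds_zero_of_lt_one (ht0 p) (htlt p hp)).abs.pow 2)
    simpa using this
  have hintI : ∀ n, Integrable (fun p => |t p ^ n - ind p| ^ 2) μ := fun n =>
    Integrable.of_bound (hmeas n) 1 (ae_of_all _ fun p => by
      rw [Real.norm_of_nonneg (by positivity)]; exact hbd n p)
  have hcont : ∀ h : C(Torus, ℂ), Integrable (fun p => ‖h p‖ ^ 2) μ := fun h =>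
    Continuous.integrable_of_hasCompactSupport (by fun_prop) (HasCompactSupport.of_compactSpace _)
  -- Every continuous function dominated by `t ^ n - ind` has small image.
  have hdom : ∀ (h : C(Torus, ℂ)) (c : ℝ) (n : ℕ), 0 ≤ c →
      (∀ p, ‖h p‖ ≤ c * |t p ^ n - ind p|) → ‖Ψ h v‖ ≤ c * √(I n) := by
    intro h c n hc hp
    have h1 : ‖Ψ h v‖ ^ 2 ≤ c ^ 2 * I n := by
      rw [hμ.norm_sq, ← integral_const_mul]
      refine integral_mono (hcont h) ((hintI n).const_mul _) fun p => ?_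
      have := pow_le_pow_left₀ (norm_nonneg _) (hp p) 2
      simpa [mul_pow] using this
    have h2 := Real.sqrt_le_sqrt h1
    rwa [Real.sqrt_sq (norm_nonneg _), Real.sqrt_mul (sq_nonneg c), Real.sqrt_sq hc] at h2
  let w : ℕ → H := fun n => Ψ (Torus.ofReal (t ^ n)) v
  have hsI : Tendsto (fun n => √(I n)) atTop (𝓝 0) := by
    simpa using hI.sqrt
  have hcau : CauchySeq w := by
    refine cauchySeq_of_le_tendsto_0 (fun n => √(I n)) (fun n m N hn hm => ?_) hsI
    rw [dist_eq_norm]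
    have h1 : w n - w m = Ψ (Torus.ofReal (t ^ n) - Torus.ofReal (t ^ m)) v := by
      rw [map_sub]; rfl
    rw [h1, ← one_mul √(I N)]
    refine hdom _ 1 N zero_le_one fun p => ?_
    rw [one_mul, ContinuousMap.sub_apply, Torus.ofReal_apply, Torus.ofReal_apply,
      ← Complex.ofReal_sub, Complex.norm_real, Real.norm_eq_abs, ContinuousMap.pow_apply,
      ContinuousMap.pow_apply]
    by_cases hp : p = 0
    · simp [hp, htz]
    · rw [hind p hp, sub_zero, abs_of_nonneg (pow_nonneg (ht0 p) N), abs_le]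
      have a1 := pow_le_pow_of_le_one (ht0 p) (ht1 p) hn
      have a2 := pow_le_pow_of_le_one (ht0 p) (ht1 p) hm
      have a3 := pow_nonneg (ht0 p) n
      have a4 := pow_nonneg (ht0 p) m
      constructor <;> linarith
  obtain ⟨w₀, hw₀⟩ := cauchySeq_tendsto_of_complete hcau
  -- A character moves `w n` by little, since `‖χ - 1‖ ≤ 2` vanishes at the origin.
  have hfix : ∀ χ : C(Torus, ℂ), (∀ p, ‖χ p - 1‖ ≤ 2) → χ 0 = 1 → Ψ χ w₀ = w₀ := by
    intro χ h2 h1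
    have hlim : Tendsto (fun n => Ψ χ (w n) - w n) atTop (𝓝 (Ψ χ w₀ - w₀)) :=
      (((Ψ χ).continuous.tendsto _).comp hw₀).sub hw₀
    refine sub_eq_zero.1 (tendsto_nhds_unique hlim ?_)
    refine squeeze_zero_norm (fun n => ?_) (by simpa using hsI.const_mul 2)
    have h3 : Ψ χ (w n) - w n = Ψ ((χ - 1) * Torus.ofReal (t ^ n)) v := by
      rw [map_mul, map_sub, map_one]; rfl
    rw [h3]
    refine hdom _ 2 n zero_le_two fun p => ?_
    rw [ContinuousMap.mul_apply, norm_mul, Torus.ofReal_apply, Complex.norm_real,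
      Real.norm_eq_abs, ContinuousMap.pow_apply]
    by_cases hp : p = 0
    · simp [hp, h1, htz, hind0]
    · rw [hind p hp, sub_zero]
      exact mul_le_mul_of_nonneg_right (h2 p) (abs_nonneg _)
  refine ⟨w₀, fun hw => ?_, hfix _ (fun p => ?_) (by simp), hfix _ (fun p => ?_) (by simp)⟩
  · have hlim : Tendsto (fun n => (inner ℂ (w n) v).re) atTop (𝓝 (inner ℂ w₀ v).re) :=
      (Complex.continuous_re.tendsto _).comp (hw₀.inner tendsto_const_nhds)
    have hge : ∀ n, μ.real {0} ≤ (inner ℂ (w n) v).re := by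
      intro n
      rw [← hμ (t ^ n), ← integral_indicator_one (measurableSet_singleton 0)]
      refine integral_mono ((integrable_const 1).indicator (measurableSet_singleton 0))
        (Continuous.integrable_of_hasCompactSupport (by fun_prop)
          (HasCompactSupport.of_compactSpace _)) fun p => ?_
      change ind p ≤ t p ^ n
      by_cases hp : p = 0
      · simp [hp, htz, hind0]
      · rw [hind p hp]
        exact pow_nonneg (ht0 p) n
    have h1 := ge_of_tendsto' hlim hge
    rw [hw, inner_zero_left, Complex.zero_re] at h1
    have h2 : 0 < μ.real {0} := ENNReal.toReal_pos h0 (measure_ne_top _ _)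
    linarith
  · rw [Torus.fstChar_apply]; exact hle _
  · rw [Torus.sndChar_apply]; exact hle _

end IsSpectralMeasure

end SpectralMeasure

/-! ### The circle near the origin -/

namespace UnitAddCircle

theorem exists_abs_eq_norm (x : UnitAddCircle) :
    ∃ a : ℝ, (a : UnitAddCircle) = x ∧ |a| = ‖x‖ ∧ |a| ≤ 1 / 2 := by
  induction x using QuotientAddGroup.induction_on with | H b => ?_
  refine ⟨b - round b, ?_, (UnitAddCircle.norm_eq).symm, abs_sub_round b⟩
  have : ((round b : ℝ) : UnitAddCircle) = 0 := by
    rw [AddCircle.coe_eq_zero_iff]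
    exact ⟨round b, by simp⟩
  rw [AddCircle.coe_sub, this, sub_zero]

theorem norm_coe_of_abs_le {a : ℝ} (ha : |a| ≤ 1 / 2) : ‖(a : UnitAddCircle)‖ = |a| :=
  (AddCircle.norm_coe_eq_abs_iff (p := (1 : ℝ)) one_ne_zero).2 (by rwa [abs_one])

theorem eq_zero_of_abs_lt_one {a : ℝ} (h : (a : UnitAddCircle) = 0) (ha : |a| < 1) : a = 0 := by
  obtain ⟨n, hn⟩ := AddCircle.coe_eq_zero_iff 1 |>.1 h
  have hn' : (n : ℝ) = a := by simpa using hn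
  have h1 : |n| < 1 := by
    rw [← hn', ← Int.cast_abs] at ha
    exact_mod_cast ha
  rw [← hn', Int.abs_lt_one_iff.1 h1, Int.cast_zero]

/-- Close to the origin a shear of the torus by `j`, `|j| = k ≥ 2`, acts linearly, and it maps the
cone `‖y‖ ≤ ‖x‖` into the cone `‖x‖ ≤ ‖y‖`. -/
theorem norm_le_norm_add_zsmul {k : ℕ} (hk : 2 ≤ k) {j : ℤ} (hj : |j| = k) {x y : UnitAddCircle}
    (hyx : ‖y‖ ≤ ‖x‖) (hx : ‖x‖ ≤ 1 / (4 * k)) : ‖x‖ ≤ ‖y + j • x‖ := by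
  obtain ⟨a, rfl, ha, -⟩ := exists_abs_eq_norm x
  obtain ⟨b, rfl, hb, -⟩ := exists_abs_eq_norm y
  rw [← ha] at hx hyx ⊢
  rw [← hb] at hyx
  have hk' : (2 : ℝ) ≤ k := by exact_mod_cast hk
  have hj' : |(j : ℝ) * a| = k * |a| := by
    rw [abs_mul, ← Int.cast_abs, hj, Int.cast_natCast]
  have hka : k * |a| ≤ 1 / 4 := by
    calc k * |a| ≤ k * (1 / (4 * k)) := by gcongr
      _ = 1 / 4 := by field_simp
  have h2a : 2 * |a| ≤ k * |a| := mul_le_mul_of_nonneg_right hk' (abs_nonneg a)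
  have h1 : (b : UnitAddCircle) + j • (a : UnitAddCircle) = ((b + j * a : ℝ) : UnitAddCircle) := by
    rw [AddCircle.coe_add, ← zsmul_eq_mul, AddCircle.coe_zsmul]
  rw [h1, norm_coe_of_abs_le]
  · have := abs_sub_abs_le_abs_sub (j * a) (-b)
    rw [abs_neg, sub_neg_eq_add, add_comm (_ * a), hj'] at this
    linarith
  · refine (abs_add_le _ _).trans ?_
    rw [hj']
    linarith

/-- The images of the cone `‖y‖ ≤ ‖x‖` under two opposite shears meet only at the origin. -/
theorem eq_zero_of_norm_shears_le {k : ℕ} (hk : 2 ≤ k) {x y : UnitAddCircle}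
    (hx : ‖x‖ ≤ 1 / (4 * k)) (h₁ : ‖y + (k : ℤ) • x‖ ≤ ‖x‖) (h₂ : ‖y + (-k : ℤ) • x‖ ≤ ‖x‖) :
    x = 0 ∧ y = 0 := by
  suffices hx0 : x = 0 by
    subst hx0
    simpa using h₁
  obtain ⟨a, hax, ha, -⟩ := exists_abs_eq_norm x
  obtain ⟨b, hbx, hb, -⟩ := exists_abs_eq_norm (y + (k : ℤ) • x)
  obtain ⟨c, hcx, hc, -⟩ := exists_abs_eq_norm (y + (-k : ℤ) • x)
  rw [← hb, ← ha] at h₁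
  rw [← hc, ← ha] at h₂
  rw [← ha] at hx
  have hk' : (2 : ℝ) ≤ k := by exact_mod_cast hk
  have hka : k * |a| ≤ 1 / 4 := by
    calc k * |a| ≤ k * (1 / (4 * k)) := by gcongr
      _ = 1 / 4 := by field_simp
  have h2a : 2 * |a| ≤ k * |a| := mul_le_mul_of_nonneg_right hk' (abs_nonneg a)
  have habs : |2 * (k * a)| = 2 * (k * |a|) := by
    rw [abs_mul, abs_mul, Nat.abs_cast, abs_two]
  have hbc : |b - c| ≤ |b| + |c| := abs_sub b c
  have hlift : ((b - c - 2 * (k * a) : ℝ) : UnitAddCircle) = 0 := by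
    have h3 : ((k * a : ℝ) : UnitAddCircle) = (k : ℤ) • x := by
      rw [← hax, ← AddCircle.coe_zsmul, zsmul_eq_mul, Int.cast_natCast]
    rw [two_mul, AddCircle.coe_sub, AddCircle.coe_sub, AddCircle.coe_add, h3, hbx, hcx, neg_smul]
    abel
  have h0 := eq_zero_of_abs_lt_one hlift <| by
    refine (abs_sub (b - c) (2 * (k * a))).trans_lt ?_
    rw [habs]
    linarith
  have h4 : 2 * (k * |a|) ≤ 2 * |a| := by
    rw [← habs, ← sub_eq_zero.1 h0]
    linarith
  have h5 : |a| = 0 := le_antisymm (by linarith) (abs_nonneg a)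
  rw [← hax, abs_eq_zero.1 h5]
  rfl

/-- The factor `1 / 2` comes from `sin (4t) ≤ 4 sin t` with `t = π / (4k)`. -/
theorem le_norm_toCircle_sub_one {k : ℕ} (hk : 2 ≤ k) {x : UnitAddCircle}
    (hx : 1 / (4 * k) ≤ ‖x‖) :
    Real.sin (Real.pi / k) / 2 ≤ ‖(AddCircle.toCircle x : ℂ) - 1‖ := by
  obtain ⟨a, rfl, ha, ha2⟩ := exists_abs_eq_norm x
  rw [← ha] at hx
  have hk' : (2 : ℝ) ≤ k := by exact_mod_cast hk
  have h1 : ‖(AddCircle.toCircle (a : UnitAddCircle) : ℂ) - 1‖ = 2 * |Real.sin (Real.pi * a)| := by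
    rw [AddCircle.toCircle_apply_mk, Circle.coe_exp, mul_comm,
      Complex.norm_exp_I_mul_ofReal_sub_one, Real.norm_eq_abs, abs_mul, abs_two]
    congr 3
    ring
  have h2 : |Real.sin (Real.pi * a)| = Real.sin (Real.pi * |a|) := by
    rw [Real.abs_sin_eq_sin_abs_of_abs_le_pi, abs_mul, abs_of_pos Real.pi_pos]
    rw [abs_mul, abs_of_pos Real.pi_pos]
    nlinarith [Real.pi_pos]
  set t := Real.pi / (4 * k) with ht
  have ht0 : 0 ≤ t := by positivity
  have h3 : Real.sin t ≤ Real.sin (Real.pi * |a|) := by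
    apply Real.sin_le_sin_of_le_of_le_pi_div_two
    · linarith [Real.pi_pos]
    · nlinarith [Real.pi_pos]
    · rw [ht, div_eq_mul_one_div]
      gcongr
  have hst : 0 ≤ Real.sin t := by
    apply Real.sin_nonneg_of_nonneg_of_le_pi ht0
    rw [ht]
    apply div_le_self Real.pi_pos.le
    linarith
  have h4 : Real.sin (Real.pi / k) ≤ 4 * Real.sin t := by
    have : Real.pi / k = 2 * (2 * t) := by rw [ht]; field_simp; norm_num
    rw [this, Real.sin_two_mul, Real.sin_two_mul]
    have h5 : Real.cos t * Real.cos (2 * t) ≤ 1 := by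
      refine (le_abs_self _).trans ?_
      rw [abs_mul]
      exact mul_le_one₀ (Real.abs_cos_le_one _) (abs_nonneg _) (Real.abs_cos_le_one _)
    nlinarith
  rw [h1, h2]
  linarith

end UnitAddCircle

/-! ### Shears and cones -/

namespace Torus

/-- The shear `(x, y) ↦ (x, y + jx)`. -/
def shearSnd (j : ℤ) : C(Torus, Torus) := ⟨fun p => (p.1, p.2 + j • p.1), by fun_prop⟩

/-- The shear `(x, y) ↦ (x + jy, y)`. -/
def shearFst (j : ℤ) : C(Torus, Torus) := ⟨fun p => (p.1 + j • p.2, p.2), by fun_prop⟩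

@[simp] theorem shearSnd_apply (j : ℤ) (p : Torus) : shearSnd j p = (p.1, p.2 + j • p.1) := rfl

@[simp] theorem shearFst_apply (j : ℤ) (p : Torus) : shearFst j p = (p.1 + j • p.2, p.2) := rfl

/-- Intertwining relations between a unitary and a representation of `C(Torus, ℂ)` need only be
checked on the coordinate characters. -/
theorem intertwines {B : Type*} [CStarAlgebra B] {Ψ : C(Torus, ℂ) →⋆ₐ[ℂ] B} {τ : C(Torus, Torus)}
    {W : unitary B} (h₁ : Ψ fstChar * W = W * Ψ (fstChar.comp τ))
    (h₂ : Ψ sndChar * W = W * Ψ (sndChar.comp τ)) (h : C(Torus, ℂ)) :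
    Ψ h * W = W * Ψ (h.comp τ) := by
  have hW : (W : B) * star (W : B) = 1 := Unitary.coe_mul_star_self W
  have hW' : star (W : B) * (W : B) = 1 := Unitary.coe_star_mul_self W
  have key : (Unitary.conjStarAlgAut ℂ B (star W) : B →⋆ₐ[ℂ] B).comp Ψ
      = Ψ.comp (ContinuousMap.compStarAlgHom' ℂ ℂ τ) := by
    have aux : ∀ g, Ψ g * W = W * Ψ (g.comp τ) →
        Unitary.conjStarAlgAut ℂ B (star W) (Ψ g) = Ψ (g.comp τ) := by
      intro g hg
      rw [Unitary.conjStarAlgAut_star_apply, mul_assoc, hg, ← mul_assoc,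
        hW', one_mul]
    exact starAlgHom_ext (aux _ h₁) (aux _ h₂)
  have h3 : star (W : B) * Ψ h * W = Ψ (h.comp τ) := by
    have := congrArg (fun φ : C(Torus, ℂ) →⋆ₐ[ℂ] B => φ h) key
    change Unitary.conjStarAlgAut ℂ B (star W) (Ψ h) = Ψ (h.comp τ) at this
    rwa [Unitary.conjStarAlgAut_star_apply] at this
  rw [← h3, ← mul_assoc, ← mul_assoc, hW, one_mul]

section Shear

variable {B : Type*} [CStarAlgebra B] {Ψ : C(Torus, ℂ) →⋆ₐ[ℂ] B} {a b W : unitary B}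

/-- If `χ` is circle-valued and `g` is its `j`-th power, then `Ψ g` is the `j`-th power of `Ψ χ`. -/
theorem map_zpow_char {χ : C(Torus, ℂ)} (hχ : Ψ χ = a) (j : ℤ) {g : C(Torus, ℂ)}
    (hg : ∀ p, ∃ z : Circle, χ p = z ∧ g p = (z ^ j : Circle)) : Ψ g = (a ^ j : unitary B) := by
  cases j with
  | ofNat n =>
    have : g = χ ^ n := by
      ext p
      obtain ⟨z, hz, h⟩ := hg p
      simp [h, hz]
    rw [this, map_pow, hχ]
    simp
  | negSucc n =>
    have : g = star χ ^ (n + 1) := by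
      ext p
      obtain ⟨z, hz, h⟩ := hg p
      simp only [h, hz, ContinuousMap.pow_apply, ContinuousMap.star_apply, zpow_negSucc,
        Circle.coe_inv_eq_conj, Circle.coe_pow, map_pow, RCLike.star_def]
    rw [this, map_pow, map_star, hχ, zpow_negSucc, ← inv_pow, ← Unitary.star_eq_inv]
    simp

theorem intertwines_shearSnd (ha : Ψ fstChar = a) (hb : Ψ sndChar = b) (j : ℤ)
    (h₁ : a * W = W * a) (h₂ : b * W = W * (b * a ^ j)) (h : C(Torus, ℂ)) :
    Ψ h * W = W * Ψ (h.comp (shearSnd j)) := by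
  refine intertwines ?_ ?_ h
  · have : fstChar.comp (shearSnd j) = fstChar := rfl
    rw [this, ha]
    exact congrArg Subtype.val h₁
  · let g : C(Torus, ℂ) := (fourier j).comp ⟨Prod.fst, continuous_fst⟩
    have hg : Ψ g = (a ^ j : unitary B) := map_zpow_char ha j fun p =>
      ⟨AddCircle.toCircle p.1, by simp, by simp [g, AddCircle.toCircle_zsmul]⟩
    have : sndChar.comp (shearSnd j) = sndChar * g := by
      ext p
      simp [g, AddCircle.toCircle_add]
    rw [this, map_mul, hg, hb]
    exact congrArg Subtype.val h₂

theorem intertwines_shearFst (ha : Ψ fstChar = a) (hb : Ψ sndChar = b) (j : ℤ)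
    (h₁ : a * W = W * (a * b ^ j)) (h₂ : b * W = W * b) (h : C(Torus, ℂ)) :
    Ψ h * W = W * Ψ (h.comp (shearFst j)) := by
  refine intertwines ?_ ?_ h
  · let g : C(Torus, ℂ) := (fourier j).comp ⟨Prod.snd, continuous_snd⟩
    have hg : Ψ g = (b ^ j : unitary B) := map_zpow_char hb j fun p =>
      ⟨AddCircle.toCircle p.2, by simp, by simp [g, AddCircle.toCircle_zsmul]⟩
    have : fstChar.comp (shearFst j) = fstChar * g := by
      ext p
      simp [g, AddCircle.toCircle_add]
    rw [this, map_mul, hg, ha]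
    exact congrArg Subtype.val h₁
  · have : sndChar.comp (shearFst j) = sndChar := rfl
    rw [this, hb]
    exact congrArg Subtype.val h₂

end Shear

/-- The closed cone `‖y‖ ≤ ‖x‖ ≤ d` around the horizontal axis. -/
def coneFst (d : ℝ) : Set Torus := {p | ‖p.2‖ ≤ ‖p.1‖ ∧ ‖p.1‖ ≤ d}

/-- The closed cone `‖x‖ ≤ ‖y‖ ≤ d` around the vertical axis. -/
def coneSnd (d : ℝ) : Set Torus := {p | ‖p.1‖ ≤ ‖p.2‖ ∧ ‖p.2‖ ≤ d}

theorem isClosed_coneFst (d : ℝ) : IsClosed (coneFst d) :=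
  (isClosed_le (f := fun p : Torus => ‖p.2‖) (by fun_prop) (by fun_prop)).inter
    (isClosed_le (f := fun p : Torus => ‖p.1‖) (by fun_prop) continuous_const)

theorem isClosed_coneSnd (d : ℝ) : IsClosed (coneSnd d) :=
  (isClosed_le (f := fun p : Torus => ‖p.1‖) (by fun_prop) (by fun_prop)).inter
    (isClosed_le (f := fun p : Torus => ‖p.2‖) (by fun_prop) continuous_const)

/-- If two maps push a closed set `D` almost without loss of measure into essentially disjoint
parts of `E ∪ N`, then `D` has at most about half the measure of `E ∪ N`. -/
theorem two_mul_measureReal_le {μ : Measure Torus} [IsFiniteMeasure μ] (h0 : μ {0} = 0)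
    {D E N : Set Torus} (hD : IsClosed D) {σ τ : C(Torus, Torus)} {δ : ℝ}
    (hσ : μ.real D ≤ μ.real (σ ⁻¹' D) + δ) (hτ : μ.real D ≤ μ.real (τ ⁻¹' D) + δ)
    (hd : σ ⁻¹' D ∩ τ ⁻¹' D ⊆ {0}) (hσE : σ ⁻¹' D ⊆ E ∪ N) (hτE : τ ⁻¹' D ⊆ E ∪ N) :
    2 * μ.real D ≤ μ.real E + μ.real N + 2 * δ := by
  have h1 := measureReal_union_add_inter (μ := μ) (s := σ ⁻¹' D)
    (hD.preimage τ.continuous).measurableSet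
  have h2 : μ.real (σ ⁻¹' D ∩ τ ⁻¹' D) = 0 := by
    rw [measureReal_def, measure_mono_null hd h0, ENNReal.toReal_zero]
  have h3 : μ.real (σ ⁻¹' D ∪ τ ⁻¹' D) ≤ μ.real (E ∪ N) :=
    measureReal_mono (Set.union_subset hσE hτE)
  have h4 := measureReal_union_le (μ := μ) E N
  linarith

theorem preimage_shearSnd_subset {k : ℕ} (hk : 2 ≤ k) {j : ℤ} (hj : |j| = k) :
    shearSnd j ⁻¹' coneFst (1 / (4 * k)) ⊆
      coneSnd (1 / (4 * k)) ∪ {p | 1 / (4 * k) ≤ ‖p.2‖} := by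
  rintro ⟨x, y⟩ ⟨h₁, h₂⟩
  have h := UnitAddCircle.norm_le_norm_add_zsmul hk (j := -j) (by rwa [abs_neg]) h₁ h₂
  simp only [shearSnd_apply, neg_smul, add_neg_cancel_right] at h
  exact (le_total ‖y‖ (1 / (4 * k))).imp (fun hy => ⟨h, hy⟩) id

theorem preimage_shearFst_subset {k : ℕ} (hk : 2 ≤ k) {j : ℤ} (hj : |j| = k) :
    shearFst j ⁻¹' coneSnd (1 / (4 * k)) ⊆
      coneFst (1 / (4 * k)) ∪ {p | 1 / (4 * k) ≤ ‖p.1‖} := by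
  rintro ⟨x, y⟩ ⟨h₁, h₂⟩
  have h := UnitAddCircle.norm_le_norm_add_zsmul hk (j := -j) (by rwa [abs_neg]) h₁ h₂
  simp only [shearFst_apply, neg_smul, add_neg_cancel_right] at h
  exact (le_total ‖x‖ (1 / (4 * k))).imp (fun hx => ⟨h, hx⟩) id

theorem preimage_shearSnd_inter_subset {k : ℕ} (hk : 2 ≤ k) :
    shearSnd (-k) ⁻¹' coneFst (1 / (4 * k)) ∩ shearSnd k ⁻¹' coneFst (1 / (4 * k)) ⊆ {0} := by
  rintro ⟨x, y⟩ ⟨⟨h₁, h₂⟩, h₃, -⟩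
  obtain ⟨rfl, rfl⟩ := UnitAddCircle.eq_zero_of_norm_shears_le hk h₂ h₃ h₁
  rfl

theorem preimage_shearFst_inter_subset {k : ℕ} (hk : 2 ≤ k) :
    shearFst (-k) ⁻¹' coneSnd (1 / (4 * k)) ∩ shearFst k ⁻¹' coneSnd (1 / (4 * k)) ⊆ {0} := by
  rintro ⟨x, y⟩ ⟨⟨h₁, h₂⟩, h₃, -⟩
  obtain ⟨rfl, rfl⟩ := UnitAddCircle.eq_zero_of_norm_shears_le hk h₂ h₃ h₁
  rfl

end Torus

/-- Conjugation by `W` multiplies `b` by `a ^ k` and fixes `a`. These are the resulting relations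
for `W` and `W⁻¹`, in the form in which they intertwine with the shears by `-k` and `k`. -/
theorem shear_relations {G : Type*} [Group G] {a b W : G} {k : ℕ} (h₁ : W * a = a * W)
    (h₂ : W * b = b * a ^ k * W) :
    b * W = W * (b * a ^ (-k : ℤ)) ∧ a * W⁻¹ = W⁻¹ * a ∧ b * W⁻¹ = W⁻¹ * (b * a ^ (k : ℤ)) := by
  have hc : Commute W a := h₁
  refine ⟨?_, hc.inv_left.eq.symm, ?_⟩
  · rw [← mul_assoc, h₂, mul_assoc _ W, (hc.zpow_right _).eq]
    simp [mul_assoc]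
  · rw [zpow_natCast, mul_inv_eq_iff_eq_mul, mul_assoc, ← h₂, inv_mul_cancel_left]

theorem pow_shear {G : Type*} [Group G] {a b W : G} {k : ℕ} (h₁ : W * a = a * W)
    (h₂ : W * b = b * a ^ k * W) (n : ℕ) : W ^ n * b = b * a ^ (n * k) * W ^ n := by
  induction n with
  | zero => simp
  | succ n ih =>
    have hc : Commute W (a ^ (n * k)) := (show Commute W a from h₁).pow_right _
    rw [pow_succ', mul_assoc, ih, ← mul_assoc, ← mul_assoc, h₂, mul_assoc _ W, hc.eq,
      ← mul_assoc, mul_assoc b, ← pow_add, mul_assoc, add_one_mul, add_comm]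

/-! ### Almost fixed vectors of four unitaries -/

section FourUnitaries

variable {H : Type u} [NormedAddCommGroup H] [InnerProductSpace ℂ H] [CompleteSpace H]

theorem norm_inv_sub_le {W : unitary (H →L[ℂ] H)} {v : H} {ε : ℝ}
    (h : ‖(W : H →L[ℂ] H) v - v‖ ≤ ε) : ‖((W⁻¹ : unitary (H →L[ℂ] H)) : H →L[ℂ] H) v - v‖ ≤ ε := by
  have h1 : (W : H →L[ℂ] H) (((W⁻¹ : unitary (H →L[ℂ] H)) : H →L[ℂ] H) v) = v := by
    exact congrArg (fun T : unitary (H →L[ℂ] H) => (T : H →L[ℂ] H) v) (mul_inv_cancel W)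
  rw [← Unitary.norm_map W, map_sub, h1, norm_sub_rev]
  exact h

theorem norm_pow_sub_le {W : unitary (H →L[ℂ] H)} {v : H} {δ : ℝ}
    (h : ‖(W : H →L[ℂ] H) v - v‖ ≤ δ) (n : ℕ) :
    ‖((W ^ n : unitary (H →L[ℂ] H)) : H →L[ℂ] H) v - v‖ ≤ n * δ := by
  induction n with
  | zero => simp
  | succ n ih =>
    have h1 : ((W ^ (n + 1) : unitary (H →L[ℂ] H)) : H →L[ℂ] H) v - v
        = ((W ^ n : unitary (H →L[ℂ] H)) : H →L[ℂ] H) ((W : H →L[ℂ] H) v - v)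
          + (((W ^ n : unitary (H →L[ℂ] H)) : H →L[ℂ] H) v - v) := by
      rw [pow_succ, map_sub, sub_add_sub_cancel]
      rfl
    rw [h1]
    refine (norm_add_le _ _).trans ?_
    rw [Unitary.norm_map, Nat.cast_add_one, add_one_mul, add_comm]
    exact add_le_add ih h

/-- Let conjugation by the unitaries `U` and `L` shear the commuting pair of unitaries `e`, `f` by
`k ≥ 2`. A unit vector that is almost fixed by all four forces a nonzero vector fixed by `e` and
`f`, since otherwise the two cones of the torus would be too small for the spectral measure. -/
theorem exists_fixed_of_almost_fixed_unit {k : ℕ} (hk : 2 ≤ k) (e f U L : unitary (H →L[ℂ] H))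
    (hef : e * f = f * e) (hUe : U * e = e * U) (hUf : U * f = f * e ^ k * U)
    (hLe : L * e = e * f ^ k * L) (hLf : L * f = f * L) {ε : ℝ}
    (hε : ε ≤ Real.sin (Real.pi / k) / 27) {v : H} (hv : ‖v‖ = 1)
    (he : ‖(e : H →L[ℂ] H) v - v‖ ≤ ε) (hf : ‖(f : H →L[ℂ] H) v - v‖ ≤ ε)
    (hU : ‖(U : H →L[ℂ] H) v - v‖ ≤ ε) (hL : ‖(L : H →L[ℂ] H) v - v‖ ≤ ε) :
    ∃ w : H, w ≠ 0 ∧ (e : H →L[ℂ] H) w = w ∧ (f : H →L[ℂ] H) w = w := by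
  obtain ⟨Ψ, hΨe, hΨf⟩ := exists_torusHom e f hef
  obtain ⟨μ, _, hμ⟩ := exists_isSpectralMeasure Ψ v
  rw [← hΨe, ← hΨf]
  by_contra hno
  have h0 : μ {0} = 0 := by
    by_contra h
    exact hno (hμ.exists_invariant_of_measure_zero_ne_zero h)
  set d : ℝ := 1 / (4 * k) with hd
  have hk' : (2 : ℝ) ≤ k := by exact_mod_cast hk
  have hsin : 0 < Real.sin (Real.pi / k) := by
    apply Real.sin_pos_of_pos_of_lt_pi (by positivity)
    apply div_lt_self Real.pi_pos
    linarith
  have hε0 : 0 ≤ ε := (norm_nonneg _).trans he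
  have hε1 : ε ≤ 1 / 27 := hε.trans (by linarith [Real.sin_le_one (Real.pi / k)])
  -- Little mass lies outside the square `‖x‖, ‖y‖ ≤ d`.
  have hsmall : ε ^ 2 / (Real.sin (Real.pi / k) / 2) ^ 2 ≤ 4 / 729 := by
    rw [div_le_iff₀ (by positivity)]
    nlinarith
  let N₁ : Set Torus := {p | d ≤ ‖p.1‖}
  let N₂ : Set Torus := {p | d ≤ ‖p.2‖}
  have hN₁ : μ.real N₁ ≤ 4 / 729 := by
    refine (hμ.measureReal_le_of_norm_sub_le Torus.fstChar (half_pos hsin) (by rwa [hΨe])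
      (measurableSet_le (by fun_prop) (by fun_prop)) fun p hp => ?_).trans hsmall
    rw [Torus.fstChar_apply]
    exact UnitAddCircle.le_norm_toCircle_sub_one hk hp
  have hN₂ : μ.real N₂ ≤ 4 / 729 := by
    refine (hμ.measureReal_le_of_norm_sub_le Torus.sndChar (half_pos hsin) (by rwa [hΨf])
      (measurableSet_le (by fun_prop) (by fun_prop)) fun p hp => ?_).trans hsmall
    rw [Torus.sndChar_apply]
    exact UnitAddCircle.le_norm_toCircle_sub_one hk hp
  -- The two cones dominate each other.
  have hj : |(k : ℤ)| = k := Nat.abs_cast k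
  have hj' : |(-k : ℤ)| = k := by rw [abs_neg, hj]
  obtain ⟨hU₁, hU₂, hU₃⟩ := shear_relations hUe hUf
  obtain ⟨hL₁, hL₂, hL₃⟩ := shear_relations hLf hLe
  have h₁ : 2 * μ.real (Torus.coneFst d) ≤ μ.real (Torus.coneSnd d) + μ.real N₂ + 2 * (2 * ε) :=
    Torus.two_mul_measureReal_le h0 (Torus.isClosed_coneFst d)
      (hμ.measureReal_le_preimage U _ (Torus.intertwines_shearSnd hΨe hΨf _ hUe.symm hU₁) hv hU
        (Torus.isClosed_coneFst d))
      (hμ.measureReal_le_preimage U⁻¹ _ (Torus.intertwines_shearSnd hΨe hΨf _ hU₂ hU₃) hv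
        (norm_inv_sub_le hU) (Torus.isClosed_coneFst d))
      (Torus.preimage_shearSnd_inter_subset hk) (Torus.preimage_shearSnd_subset hk hj')
      (Torus.preimage_shearSnd_subset hk hj)
  have h₂ : 2 * μ.real (Torus.coneSnd d) ≤ μ.real (Torus.coneFst d) + μ.real N₁ + 2 * (2 * ε) :=
    Torus.two_mul_measureReal_le h0 (Torus.isClosed_coneSnd d)
      (hμ.measureReal_le_preimage L _ (Torus.intertwines_shearFst hΨe hΨf _ hL₁ hLf.symm) hv hL
        (Torus.isClosed_coneSnd d))
      (hμ.measureReal_le_preimage L⁻¹ _ (Torus.intertwines_shearFst hΨe hΨf _ hL₃ hL₂) hv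
        (norm_inv_sub_le hL) (Torus.isClosed_coneSnd d))
      (Torus.preimage_shearFst_inter_subset hk) (Torus.preimage_shearFst_subset hk hj')
      (Torus.preimage_shearFst_subset hk hj)
  have hcover : Set.univ ⊆ (Torus.coneFst d ∪ Torus.coneSnd d) ∪ (N₁ ∪ N₂) := by
    rintro p -
    rcases le_total ‖p.1‖ d with h1 | h1
    · rcases le_total ‖p.2‖ d with h2 | h2
      · exact Or.inl ((le_total ‖p.2‖ ‖p.1‖).imp (fun h => ⟨h, h1⟩) (fun h => ⟨h, h2⟩))
      · exact Or.inr (Or.inr h2)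
    · exact Or.inr (Or.inl h1)
  have hone : μ.real Set.univ = 1 := by rw [hμ.measureReal_univ, hv, one_pow]
  have h₃ := measureReal_mono (μ := μ) hcover
  have h₄ := measureReal_union_le (μ := μ) (Torus.coneFst d ∪ Torus.coneSnd d) (N₁ ∪ N₂)
  have h₅ := measureReal_union_le (μ := μ) (Torus.coneFst d) (Torus.coneSnd d)
  have h₆ := measureReal_union_le (μ := μ) N₁ N₂
  -- The cones have total mass at most `8ε + 8/729`, so `1 ≤ 8/27 + 16/729`.
  linarith

theorem exists_fixed_of_almost_fixed {k : ℕ} (hk : 2 ≤ k) (e f U L : unitary (H →L[ℂ] H))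
    (hef : e * f = f * e) (hUe : U * e = e * U) (hUf : U * f = f * e ^ k * U)
    (hLe : L * e = e * f ^ k * L) (hLf : L * f = f * L) {ε : ℝ}
    (hε : ε ≤ Real.sin (Real.pi / k) / 27) {v : H} (hv : v ≠ 0)
    (he : ‖(e : H →L[ℂ] H) v - v‖ ≤ ε * ‖v‖) (hf : ‖(f : H →L[ℂ] H) v - v‖ ≤ ε * ‖v‖)
    (hU : ‖(U : H →L[ℂ] H) v - v‖ ≤ ε * ‖v‖) (hL : ‖(L : H →L[ℂ] H) v - v‖ ≤ ε * ‖v‖) :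
    ∃ w : H, w ≠ 0 ∧ (e : H →L[ℂ] H) w = w ∧ (f : H →L[ℂ] H) w = w := by
  have hv' : 0 < ‖v‖ := norm_pos_iff.2 hv
  have key : ∀ W : unitary (H →L[ℂ] H), ‖(W : H →L[ℂ] H) v - v‖ ≤ ε * ‖v‖ →
      ‖(W : H →L[ℂ] H) (((‖v‖⁻¹ : ℝ) : ℂ) • v) - ((‖v‖⁻¹ : ℝ) : ℂ) • v‖ ≤ ε := by
    intro W hW
    rw [map_smul, ← smul_sub, norm_smul, Complex.norm_real, norm_inv, norm_norm,
      inv_mul_le_iff₀ hv', mul_comm]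
    exact hW
  refine exists_fixed_of_almost_fixed_unit hk e f U L hef hUe hUf hLe hLf hε ?_ (key e he) (key f hf)
    (key U hU) (key L hL)
  rw [norm_smul, Complex.norm_real, norm_inv, norm_norm, inv_mul_cancel₀ hv'.ne']

end FourUnitaries

/-! ### The semidirect product -/

namespace RelKazhdan

open SemidirectProduct

variable (m l : ℕ)

/-- The generator `(l, 0)` of `(lℤ)²`. -/
def vecFst : SDP m l := vec m l (gen l) 0

/-- The generator `(0, l)` of `(lℤ)²`. -/
def vecSnd : SDP m l := vec m l 0 (gen l)

/-- The upper elementary matrix with entry `m`. -/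
def upper : SDP m l := elem m l (zero_ne_one (α := Fin 2)) (gen m)

/-- The lower elementary matrix with entry `m`. -/
def lower : SDP m l := elem m l (one_ne_zero (α := Fin 2)) (gen m)

theorem vec_add (a b c d : R l) : vec m l (a + c) (b + d) = vec m l a b * vec m l c d := by
  rw [vec, vec, vec, ← map_mul, ← ofAdd_add]
  congr 2
  ext i
  fin_cases i <;> rfl

/-- The vectors as a homomorphism from the additive group `lℤ × lℤ`. -/
def vecHom : Multiplicative (R l × R l) →* SDP m l where
  toFun p := vec m l p.toAdd.1 p.toAdd.2
  map_one' := by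
    change vec m l 0 0 = 1
    rw [vec, ← map_one inl]
    congr 1
    ext i
    fin_cases i <;> rfl
  map_mul' p q := vec_add m l _ _ _ _

theorem vec_pow (a b : R l) (n : ℕ) : vec m l a b ^ n = vec m l (n • a) (n • b) :=
  (map_pow (vecHom m l) (Multiplicative.ofAdd (a, b)) n).symm

theorem vec_zpow (a b : R l) (n : ℤ) : vec m l a b ^ n = vec m l (n • a) (n • b) :=
  (map_zpow (vecHom m l) (Multiplicative.ofAdd (a, b)) n).symm

theorem vec_comm (a b c d : R l) : vec m l a b * vec m l c d = vec m l c d * vec m l a b := by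
  rw [← vec_add, ← vec_add, add_comm a, add_comm b]

theorem elem_mul_vec {i j : Fin 2} (hij : i ≠ j) (r : R m) (a b c d : R l)
    (h : (Matrix.transvection i j (r : ℤ)).mulVec ![(a : ℤ), b] = ![(c : ℤ), d]) :
    elem m l hij r * vec m l a b = vec m l c d * elem m l hij r := by
  rw [elem, vec, vec]
  rw [← mul_inv_eq_iff_eq_mul, ← map_inv, ← SemidirectProduct.inl_aut]
  congr 1
  exact congrArg Multiplicative.ofAdd (Subtype.ext h)

theorem upper_mul_vecFst : upper m l * vecFst m l = vecFst m l * upper m l := by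
  refine elem_mul_vec m l _ _ _ _ _ _ ?_
  ext i
  fin_cases i <;> simp [Matrix.transvection, Matrix.mulVec, dotProduct, Fin.sum_univ_two, gen,
    Matrix.single, Matrix.one_apply]

theorem upper_mul_vecSnd :
    upper m l * vecSnd m l = vecSnd m l * vecFst m l ^ m * upper m l := by
  rw [vecSnd, vecFst, vec_pow, ← vec_add]
  refine elem_mul_vec m l _ _ _ _ _ _ ?_
  ext i
  fin_cases i <;> simp [Matrix.transvection, Matrix.mulVec, dotProduct, Fin.sum_univ_two, gen,
    Matrix.single, Matrix.one_apply]

theorem lower_mul_vecSnd : lower m l * vecSnd m l = vecSnd m l * lower m l := by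
  refine elem_mul_vec m l _ _ _ _ _ _ ?_
  ext i
  fin_cases i <;> simp [Matrix.transvection, Matrix.mulVec, dotProduct, Fin.sum_univ_two, gen,
    Matrix.single, Matrix.one_apply]

theorem lower_mul_vecFst :
    lower m l * vecFst m l = vecFst m l * vecSnd m l ^ m * lower m l := by
  rw [vecSnd, vecFst, vec_pow, ← vec_add]
  refine elem_mul_vec m l _ _ _ _ _ _ ?_
  ext i
  fin_cases i <;> simp [Matrix.transvection, Matrix.mulVec, dotProduct, Fin.sum_univ_two, gen,
    Matrix.single, Matrix.one_apply]

theorem vecSubgroup_le {K : Subgroup (SDP m l)} (h₁ : vecFst m l ∈ K) (h₂ : vecSnd m l ∈ K) :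
    vecSubgroup m l ≤ K := by
  rintro _ ⟨x, rfl⟩
  obtain ⟨a, ha⟩ := x.toAdd.2 0
  obtain ⟨b, hb⟩ := x.toAdd.2 1
  have : (inl x : SDP m l) = vecFst m l ^ a * vecSnd m l ^ b := by
    rw [vecFst, vecSnd, vec_zpow, vec_zpow, ← vec_add, vec]
    congr 1
    refine congrArg Multiplicative.ofAdd (Subtype.ext (funext fun i => ?_))
    fin_cases i
    · exact ha.trans (by simp [gen, mul_comm])
    · exact hb.trans (by simp [gen, mul_comm])
  rw [this]
  exact K.mul_mem (K.zpow_mem h₁ a) (K.zpow_mem h₂ b)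

theorem elem_zpow {i j : Fin 2} (hij : i ≠ j) (r : R m) (n : ℤ) :
    elem m l hij r ^ n = elem m l hij (n • r) := by
  have hadd : ∀ r s : ℤ, Matrix.SpecialLinearGroup.transvection hij (r + s)
      = Matrix.SpecialLinearGroup.transvection hij r
        * Matrix.SpecialLinearGroup.transvection hij s := fun r s =>
    Subtype.ext (Matrix.transvection_mul_transvection_same i j hij r s).symm
  let φ : Multiplicative (R m) →* SDP m l := MonoidHom.mk' (fun r => elem m l hij r.toAdd)
    fun r s => by
      rw [elem, elem, elem, ← map_mul]
      exact congrArg _ (Subtype.ext (hadd _ _))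
  exact (map_zpow φ (Multiplicative.ofAdd r) n).symm

theorem finite_F : (F m l).Finite := by
  simp [F]

theorem closure_F : Subgroup.closure (F m l) = ⊤ := by
  have hU : upper m l ∈ Subgroup.closure (F m l) := Subgroup.subset_closure (by simp [F, upper])
  have hL : lower m l ∈ Subgroup.closure (F m l) := Subgroup.subset_closure (by simp [F, lower])
  have he : vecFst m l ∈ Subgroup.closure (F m l) := Subgroup.subset_closure (by simp [F, vecFst])
  have hf : vecSnd m l ∈ Subgroup.closure (F m l) := Subgroup.subset_closure (by simp [F, vecSnd])
  rw [eq_top_iff]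
  rintro g -
  rw [← inl_left_mul_inr_right g]
  refine mul_mem (vecSubgroup_le m l he hf ⟨_, rfl⟩) ?_
  obtain ⟨g, hg⟩ := g.right
  induction hg using Subgroup.closure_induction with
  | mem x hx =>
    obtain ⟨i, j, hij, r, hr, rfl⟩ := id hx
    obtain ⟨n, rfl⟩ := id hr
    have hn : (⟨m * n, hr⟩ : R m) = n • gen m := Subtype.ext (by simp [gen, mul_comm])
    change elem m l hij ⟨m * n, hr⟩ ∈ _
    rw [hn, ← elem_zpow]
    refine zpow_mem ?_ n
    fin_cases i <;> fin_cases j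
    · exact absurd rfl hij
    · exact hU
    · exact hL
    · exact absurd rfl hij
  | one => exact one_mem _
  | mul x y hx hy h₁ h₂ =>
    have := mul_mem h₁ h₂
    rwa [← map_mul] at this
  | inv x hx h =>
    have := inv_mem h
    rwa [← map_inv] at this

variable {m l}

/-- The `n`-th powers of the elementary matrices with entry `m` shear by `nm`. They move an almost
invariant vector at most `n` times as far, so `ε` is admissible as soon as `nm ≥ 2` and `nε` is
small enough for shears by `nm`. The choice `n = 2` serves `m = 1`. -/
theorem isRelKazhdanBound_of_shear {n : ℕ} (hn : 2 ≤ n * m) {ε : ℝ} (hε0 : 0 ≤ ε)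
    (hn0 : n * ε ≤ Real.sin (Real.pi / (n * m : ℕ)) / 27) :
    IsRelKazhdanBound.{u} (vecSubgroup m l) (F m l) ε := by
  rintro H _ _ _ π ⟨v, hv, hS⟩
  have hn1 : 1 ≤ n := Nat.one_le_iff_ne_zero.2 (by rintro rfl; simp at hn)
  have hpow : ∀ g ∈ F m l, ‖((π g ^ n : unitary (H →L[ℂ] H)) : H →L[ℂ] H) v - v‖
      ≤ n * ε * ‖v‖ := by
    intro g hg
    rw [mul_assoc]
    exact norm_pow_sub_le (hS g hg) n
  have hone : ∀ g ∈ F m l, ‖(π g : H →L[ℂ] H) v - v‖ ≤ n * ε * ‖v‖ := by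
    intro g hg
    refine (hS g hg).trans ?_
    gcongr
    exact le_mul_of_one_le_left hε0 (by exact_mod_cast hn1)
  have hef : π (vecFst m l) * π (vecSnd m l) = π (vecSnd m l) * π (vecFst m l) := by
    rw [← map_mul, ← map_mul]
    exact congrArg π (vec_comm m l _ _ _ _)
  have hUe : π (upper m l) ^ n * π (vecFst m l) = π (vecFst m l) * π (upper m l) ^ n := by
    rw [← map_pow, ← map_mul, ← map_mul]
    exact congrArg π ((show Commute _ _ from upper_mul_vecFst m l).pow_left n).eq
  have hLf : π (lower m l) ^ n * π (vecSnd m l) = π (vecSnd m l) * π (lower m l) ^ n := by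
    rw [← map_pow, ← map_mul, ← map_mul]
    exact congrArg π ((show Commute _ _ from lower_mul_vecSnd m l).pow_left n).eq
  have hUf : π (upper m l) ^ n * π (vecSnd m l)
      = π (vecSnd m l) * π (vecFst m l) ^ (n * m) * π (upper m l) ^ n := by
    simp only [← map_pow, ← map_mul]
    exact congrArg π (pow_shear (upper_mul_vecFst m l) (upper_mul_vecSnd m l) n)
  have hLe : π (lower m l) ^ n * π (vecFst m l)
      = π (vecFst m l) * π (vecSnd m l) ^ (n * m) * π (lower m l) ^ n := by
    simp only [← map_pow, ← map_mul]
    exact congrArg π (pow_shear (lower_mul_vecSnd m l) (lower_mul_vecFst m l) n)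
  obtain ⟨w, hw, hew, hfw⟩ := exists_fixed_of_almost_fixed hn (π (vecFst m l)) (π (vecSnd m l))
    (π (upper m l) ^ n) (π (lower m l) ^ n) hef hUe hUf hLe hLf hn0 hv
    (hone _ (by simp [F, vecFst])) (hone _ (by simp [F, vecSnd]))
    (hpow _ (by simp [F, upper])) (hpow _ (by simp [F, lower]))
  let K : Subgroup (SDP m l) :=
    { carrier := {g | (π g : H →L[ℂ] H) w = w}
      one_mem' := by simp
      mul_mem' := fun {a b} ha hb => by
        change (π (a * b) : H →L[ℂ] H) w = w
        rw [map_mul]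
        change (π a : H →L[ℂ] H) ((π b : H →L[ℂ] H) w) = w
        rw [hb, ha]
      inv_mem' := fun {a} ha => by
        change (π a⁻¹ : H →L[ℂ] H) w = w
        have h := norm_inv_sub_le (W := π a) (v := w) (ε := 0) (by rw [ha]; simp)
        rw [map_inv]
        exact sub_eq_zero.1 (norm_le_zero_iff.1 h) }
  exact ⟨w, hw, vecSubgroup_le m l (K := K) hew hfw⟩

end RelKazhdan

theorem theorem6p2 (m l : ℕ) (hm : 1 ≤ m) (hl : 1 ≤ l) :
    (RelKazhdan.F m l).Finite ∧
    Subgroup.closure (RelKazhdan.F m l) = ⊤ ∧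
    RelKazhdan.HasRelPropertyT.{u} (RelKazhdan.vecSubgroup m l) ∧
    RelKazhdan.IsRelKazhdanBound.{u} (RelKazhdan.vecSubgroup m l) (RelKazhdan.F m l)
      (Real.sin (Real.pi / m) / 27) ∧
    ((Real.sin (Real.pi / m) / 27 : ℝ) : EReal) ≤
      RelKazhdan.relKazhdanConstant.{u} (RelKazhdan.vecSubgroup m l) (RelKazhdan.F m l) := by
  have hm' : (1 : ℝ) ≤ m := by exact_mod_cast hm
  have hsin : 0 ≤ Real.sin (Real.pi / m) / 27 := by
    have := Real.sin_nonneg_of_nonneg_of_le_pi (x := Real.pi / m) (by positivity)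
      (div_le_self Real.pi_pos.le hm')
    positivity
  have hbound : RelKazhdan.IsRelKazhdanBound.{u} (RelKazhdan.vecSubgroup m l) (RelKazhdan.F m l)
      (Real.sin (Real.pi / m) / 27) := by
    rcases hm.eq_or_lt with rfl | h2
    · -- The bound is `sin π / 27 = 0`.
      refine RelKazhdan.isRelKazhdanBound_of_shear (n := 2) le_rfl hsin ?_
      norm_num
    · exact RelKazhdan.isRelKazhdanBound_of_shear (n := 1) (by omega) hsin (by simp)
  refine ⟨RelKazhdan.finite_F m l, RelKazhdan.closure_F m l,
    ⟨RelKazhdan.F m l, RelKazhdan.finite_F m l, RelKazhdan.closure_F m l, ?_⟩, hbound,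
    le_sSup ⟨_, ⟨hsin, hbound⟩, rfl⟩⟩
  rcases hm.eq_or_lt with rfl | h2
  · -- Here `sin (π / m) = 0`, so the squares of the elementary matrices are used instead.
    refine ⟨1 / 54, by norm_num, RelKazhdan.isRelKazhdanBound_of_shear (n := 2) le_rfl ?_ ?_⟩ <;>
      norm_num
  · refine ⟨_, ?_, hbound⟩
    have : (1 : ℝ) < m := by exact_mod_cast h2
    have := Real.sin_pos_of_pos_of_lt_pi (x := Real.pi / m) (by positivity)
      (div_lt_self Real.pi_pos this)
    positivity
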